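/- Let $M>0$ and let $\alpha(r)=1-\frac{2M}{r}$ for $r>2M$. Consider the exterior Schwarzschild metric $$g=-\alpha(r)\,d\tau^2+\alpha(r)^{-1}dr^2+r^2\,d\theta^2+r^2\sin^2\theta\,d\phi^2 ,\qquad r>2M,$$ whose geodesics are the solutions of the Euler–Lagrange equations of $\mathcal{L}(q,\dot q)=\frac12 g_{\mu\nu}\dot q^\mu\dot q^\nu$, $q=(\tau,r,\theta,\phi)$; along a geodesic the energy $p_\tau=\partial_{\dot\tau}\mathcal{L}=-\alpha(r)\dot\tau$ and the angular momentum $p_\phi=\partial_{\dot\phi}\mathcal{L}=r^2\sin^2\theta\,\dot\phi$ are constant. A geodesic $q:\mathbb{R}\to\mathbb{R}^4$ is called timelike if $g_{\mu\nu}\dot q^\mu\dot q^\nu\equiv-1$ (proper-time parametrization), equatorial if $\theta\equiv\pi/2$, circular if $r$ is constant, and closed if its spatial part $(r,\theta,\phi \bmod 2\pi)$ is $T$-periodic for some $T>0$. Let $E\in(\sqrt{25/27},1)$. For $H<0$ and $L>4\sqrt2\sqrt{-H}\,M$ put $$W(r;H,L)=\tfrac12\Big(\frac{L^2}{r^2}-2H\Big)\alpha(r),\qquad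 r_0(H,L)=\frac{L^2+L\sqrt{L^2+24HM^2}}{-4HM},$$ where $r_0(H,L)$ is the local minimum point of $W(\cdot;H,L)$. If $W(r_0(H,L);H,L)<\frac12E^2<-H$, let $r_-(H,L)<r_0(H,L)<r_+(H,L)$ be the solutions of $W(r;H,L)=\frac12E^2$ that are closest to $r_0(H,L)$ on either side, and define the apsidal angle $$\Theta(H,L)=\sqrt2\,L\int_{1/r_+(H,L)}^{1/r_-(H,L)}\frac{dx}{\sqrt{\frac12E^2-W(1/x;H,L)}} .$$ Let $\zeta:(4\sqrt2,+\infty)\to(\frac{25}{27},1)$ be the bijection $$\zeta(u)=\frac{u^4-20u^2+32+u(u^2-8)\sqrt{u^2-24}}{u^4-18u^2+u(u^2-6)\sqrt{u^2-24}},$$ and let $L_E=\frac{M}{\sqrt2}\,\zeta^{-1}(E^2)$. Then there exists a set $\mathcal{L}_E\subset(4M,L_E)$, dense in $(4M,L_E)$, such that for every $L\in\mathcal{L}_E$ there exists an equatorial, timelike, non-circular, closed geodesic of the Schwarzschild metric with energy $p_\tau=E$ and angular momentum $p_\phi=L$, and the non-degeneracy condition $\partial_L\Theta(-\tfrac12,L)\neq0$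 holds. -/

import Mathlib

open Set Real

noncomputable section

namespace Schwarzschild

/-! Points of the exterior region are written in the coordinates
`q 0 = τ` (time), `q 1 = r`, `q 2 = θ` (colatitude), `q 3 = φ` (azimuth, lifted to `ℝ`). -/

/-- The function `α(r) = 1 - 2M/r`. -/
def alpha (M r : ℝ) : ℝ := 1 - 2 * M / r

/-- The matrix of the Schwarzschild metric of mass `M` in the coordinates `(τ, r, θ, φ)`. -/
def metric (M : ℝ) (q : Fin 4 → ℝ) : Matrix (Fin 4) (Fin 4) ℝ :=
  Matrix.diagonal
    ![-alpha M (q 1), (alpha M (q 1))⁻¹, q 1 ^ 2, q 1 ^ 2 * Real.sin (q 2) ^ 2]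

/-- The Lagrangian of the free particle, `½ g_{μν}(q) v^μ v^ν`. -/
def lagrangian (M : ℝ) (q v : Fin 4 → ℝ) : ℝ :=
  (1 / 2) * ∑ μ, ∑ ν, metric M q μ ν * v μ * v ν

/-- The canonical momentum `p_μ`: the partial derivative of the Lagrangian with respect to the
`μ`-th velocity. -/
def momentum (M : ℝ) (μ : Fin 4) (q v : Fin 4 → ℝ) : ℝ :=
  deriv (fun w => lagrangian M q (Function.update v μ w)) (v μ)

/-- The partial derivative of the Lagrangian with respect to the `μ`-th coordinate. -/
def force (M : ℝ) (μ : Fin 4) (q v : Fin 4 → ℝ) : ℝ :=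
  deriv (fun x => lagrangian M (Function.update q μ x) v) (q μ)

/-- A (complete, affinely parametrized) geodesic of the Schwarzschild metric outside the event
horizon: a solution, on the whole real line, of the Euler–Lagrange equations
`d/dt (∂L/∂q̇^μ) = ∂L/∂q^μ`. -/
structure IsGeodesic (M : ℝ) (q : ℝ → Fin 4 → ℝ) : Prop where
  contDiff : ContDiff ℝ 2 q
  outside_horizon : ∀ t, 2 * M < q t 1
  colatitude_mem : ∀ t, q t 2 ∈ Ioo 0 π
  euler_lagrange : ∀ μ t,
    HasDerivAt (fun s => momentum M μ (q s) (deriv q s)) (force M μ (q t) (deriv q t)) t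

/-- The curve lies in the equatorial plane. -/
def IsEquatorial (q : ℝ → Fin 4 → ℝ) : Prop := ∀ t, q t 2 = π / 2

/-- The curve is timelike and parametrized by proper time: `g_{μν} q̇^μ q̇^ν = -1`. -/
def IsTimelike (M : ℝ) (q : ℝ → Fin 4 → ℝ) : Prop :=
  ∀ t, ∑ μ, ∑ ν, metric M (q t) μ ν * deriv q t μ * deriv q t ν = -1

/-- The curve has constant radius. -/
def IsCircular (q : ℝ → Fin 4 → ℝ) : Prop := ∃ c, ∀ t, q t 1 = c

/-- The curve is closed in space: for some `T > 0` the spatial position, read in the spherical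
coordinates `(r, θ, φ mod 2π)`, is a `T`-periodic function of the proper time. -/
def IsSpatiallyClosed (q : ℝ → Fin 4 → ℝ) : Prop :=
  ∃ T : ℝ, 0 < T ∧ ∃ k : ℤ, ∀ t,
    q (t + T) 1 = q t 1 ∧ q (t + T) 2 = q t 2 ∧ q (t + T) 3 = q t 3 + 2 * π * k

/-- The particle energy `p_τ` is constantly equal to `E`. -/
def HasEnergy (M E : ℝ) (q : ℝ → Fin 4 → ℝ) : Prop :=
  ∀ t, momentum M 0 (q t) (deriv q t) = E

/-- The angular momentum `p_φ` is constantly equal to `L`. -/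
def HasAngularMomentum (M L : ℝ) (q : ℝ → Fin 4 → ℝ) : Prop :=
  ∀ t, momentum M 3 (q t) (deriv q t) = L

/-- The effective potential `W(r; H, L) = ½ (L²/r² - 2H) α(r)`. -/
def W (M H L r : ℝ) : ℝ := (1 / 2) * (L ^ 2 / r ^ 2 - 2 * H) * alpha M r

/-- The minimum point `r₀(H, L)` of `W(·; H, L)`. -/
def rZero (M H L : ℝ) : ℝ :=
  (L ^ 2 + L * √(L ^ 2 + 24 * H * M ^ 2)) / (-4 * H * M)

/-- The inner turning point `r₋(H, L)`: the solution of `W(r; H, L) = E²/2` next to `r₀` on its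
left (a further solution exists closer to the horizon, left of the maximum point of `W`). -/
def rMinus (M E H L : ℝ) : ℝ :=
  sSup {r | r ∈ Ioo (2 * M) (rZero M H L) ∧ W M H L r = E ^ 2 / 2}

/-- The outer turning point `r₊(H, L)`: the solution of `W(r; H, L) = E²/2` next to `r₀` on its
right. -/
def rPlus (M E H L : ℝ) : ℝ :=
  sInf {r | r ∈ Ioi (rZero M H L) ∧ W M H L r = E ^ 2 / 2}

/-- The apsidal angle
`Θ(H, L) = √2 L ∫_{1/r₊}^{1/r₋} dx / √(E²/2 - W(1/x; H, L))`. -/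
def Theta (M E H L : ℝ) : ℝ :=
  √2 * L * ∫ x in (1 / rPlus M E H L)..(1 / rMinus M E H L),
    1 / √(E ^ 2 / 2 - W M H L (1 / x))

/-- The auxiliary function `ζ`, considered on `(4√2, ∞)`; it maps this half-line bijectively
onto `(25/27, 1)`. -/
def zeta (u : ℝ) : ℝ :=
  (u ^ 4 - 20 * u ^ 2 + 32 + u * (u ^ 2 - 8) * √(u ^ 2 - 24)) /
    (u ^ 4 - 18 * u ^ 2 + u * (u ^ 2 - 6) * √(u ^ 2 - 24))

/-- `L_E = (M/√2) ζ⁻¹(E²)`, with `ζ⁻¹` the inverse of `ζ : (4√2, ∞) → (25/27, 1)`. -/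
def LE (M E : ℝ) : ℝ := M / √2 * Function.invFunOn zeta (Ioi (4 * √2)) (E ^ 2)

end Schwarzschild

end

/-!
The variable `u = 2M/r` and the parameters `κ = 1 - E²`, `σ = 4M²/L²` turn `E²/2 - W` into
`1/(2σ)` times the cubic `u³ - u² + σ(u - κ)`, whose roots add up to `1`. For `4M < L < L_E` there
are three roots `0 < a < b < c` with `c = 1 - a - b` (`exists_isTurningPair`): `L_E` is the angular
momentum of the circular orbit of energy `E`, because `ζ` expresses the squared energy of a circular
orbit by `√2 L/M` (`zeta_eq`).

The substitution `u = (a + b)/2 - (b - a)/2 · cos t` turns the apsidal angle into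
`∫₀^{2π} (A + B cos t)^{-1/2} dt` with `A = 1 - 3(a + b)/2` and `B = (b - a)/2`
(`IsTurningPair.Theta_eq`). Since `κ < a`, differentiating the cubic shows that, as `σ` grows, `a`
decreases, while `b` and `a + b` increase; hence `A` decreases and `B` increases. The integral is
decreasing in `A` and, by convexity and symmetry of the cosine, nondecreasing in `B`. So the apsidal
angle has positive derivative in `σ`, and `∂Θ/∂L ≠ 0` for every admissible `L`
(`exists_hasDerivAt_Theta`).

Consequently the values of `L` for which `Θ` is a rational multiple of `2π` are dense
(`Ioo_subset_closure_setOf_eq_mul_rat`). For such `L` the orbit is closed; it is given explicitly in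
terms of the anomaly `t`, whose evolution in proper time is a scalar autonomous equation with
positive periodic right-hand side (`exists_periodic_flow`, `exists_closed_geodesic`). No division by
the radial velocity occurs, so the turning points need no separate treatment.
-/

noncomputable section

namespace Schwarzschild

open Filter Topology MeasureTheory

/-! ### The cubic of the radial motion -/

/-- In the variable `u = 2M/r`, with `κ = 1 - E²` and `σ = 4M²/L²`, the difference `E²/2 - W` is
`1/(2σ)` times the cubic `u³ - u² + σ(u - κ)`. The pair `a < b` is a turning pair when the roots of
that cubic are `0 < a < b < 1 - a - b`; the bound motion then takes place in `a ≤ u ≤ b`. The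
equations are Vieta's relations, the relation for the sum being used to eliminate the third root. -/
structure IsTurningPair (κ σ a b : ℝ) : Prop where
  pos : 0 < a
  lt : a < b
  lt_third : b < 1 - a - b
  sum_mul : a * b + (a + b) * (1 - a - b) = σ
  mul : a * b * (1 - a - b) = κ * σ

namespace IsTurningPair

variable {κ σ a b : ℝ}

theorem of_roots (ha : 0 < a) (hab : a < b) (hb : b < 1 - a - b)
    (hpa : a ^ 3 - a ^ 2 + σ * (a - κ) = 0) (hpb : b ^ 3 - b ^ 2 + σ * (b - κ) = 0) :
    IsTurningPair κ σ a b := by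
  have h : a ^ 2 + a * b + b ^ 2 - (a + b) + σ = 0 := by
    apply mul_left_cancel₀ (sub_ne_zero.2 hab.ne)
    linear_combination hpa - hpb
  exact ⟨ha, hab, hb, by linear_combination -h, by linear_combination hpa - a * h⟩

theorem cubic_eq (h : IsTurningPair κ σ a b) (u : ℝ) :
    u ^ 3 - u ^ 2 + σ * (u - κ) = (u - a) * (u - b) * (u - (1 - a - b)) := by
  linear_combination -u * h.sum_mul + h.mul

/-- Dividing the last two of Vieta's relations gives `1/κ = 1/a + 1/b + 1/(1 - a - b)`. -/
theorem kappa_lt (h : IsTurningPair κ σ a b) : κ < a := by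
  obtain ⟨h0, h1, h2, h3, h4⟩ := h
  have hb : 0 < b := h0.trans h1
  have hc : 0 < 1 - a - b := hb.trans h2
  have hσ : 0 < σ := by rw [← h3]; positivity
  have : 0 < (a - κ) * σ := by
    have : (a - κ) * σ = a ^ 2 * (b + (1 - a - b)) := by rw [sub_mul, ← h4, ← h3]; ring
    rw [this]; positivity
  nlinarith

/-- With `σ = y(2 - 3y)` the point `y` is the local maximum point of the cubic; the last hypothesis
says that the cubic is positive there. As `σ < 1/4`, it is negative at `0` and at `1/2`. -/
theorem exists_of_peak_pos {y : ℝ} (hκ : 0 < κ) (hy : 0 < y) (hy' : y < 1 / 6)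
    (h : κ * (2 - 3 * y) < y * (1 - 2 * y)) : ∃ a b, IsTurningPair κ (y * (2 - 3 * y)) a b := by
  have hσ : 0 < y * (2 - 3 * y) := mul_pos hy (by linarith)
  set p : ℝ → ℝ := fun u => u ^ 3 - u ^ 2 + y * (2 - 3 * y) * (u - κ) with hp
  have hc : Continuous p := by fun_prop
  have p0 : p 0 < 0 := by simp only [hp]; nlinarith
  have p1 : 0 < p y := by
    have : p y = y * (y * (1 - 2 * y) - κ * (2 - 3 * y)) := by simp only [hp]; ring
    rw [this]; exact mul_pos hy (by linarith)
  have p2 : p (1 / 2) < 0 := by simp only [hp]; nlinarith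
  obtain ⟨a, ha, hpa⟩ := intermediate_value_Ioo hy.le hc.continuousOn (mem_Ioo.2 ⟨p0, p1⟩)
  obtain ⟨b, hb, hpb⟩ := intermediate_value_Ioo' (by linarith : y ≤ 1 / 2) hc.continuousOn
    (mem_Ioo.2 ⟨p2, p1⟩)
  refine ⟨a, b, of_roots ha.1 (ha.2.trans hb.1) ?_ hpa hpb⟩
  have hab : a < b := ha.2.trans hb.1
  have e : a ^ 2 + a * b + b ^ 2 - (a + b) + y * (2 - 3 * y) = 0 := by
    apply mul_left_cancel₀ (sub_ne_zero.2 hab.ne)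
    simp only [hp] at hpa hpb
    linear_combination hpa - hpb
  have f : p (1 / 2) = (1 / 2 - a) * (1 / 2 - b) * (1 / 2 - (1 - a - b)) := by
    simp only [hp] at hpa ⊢
    linear_combination hpa + (1 / 2 - a) * e
  by_contra hcon
  push Not at hcon
  have : 0 ≤ p (1 / 2) := by
    rw [f]
    exact mul_nonneg (mul_nonneg (by linarith [ha.2]) (by linarith [hb.2])) (by linarith [hb.2])
  linarith

end IsTurningPair

/-! ### Circular orbits and the range of angular momenta -/

/-- If `y = 2M/r₀` and `U = √2 L/M`, then `U² = 8/σ` with `σ = y(2 - 3y)`, and `ζ(U)` is the squared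
energy `2(1 - y)²/(2 - 3y)` of the circular orbit of radius `r₀`. -/
theorem zeta_eq {U y : ℝ} (hU : 0 < U) (hy : 0 < y) (hy' : y < 1 / 6)
    (h : U ^ 2 * (y * (2 - 3 * y)) = 8) : zeta U = 2 * (1 - y) ^ 2 / (2 - 3 * y) := by
  have hs : √(U ^ 2 - 24) = U * (1 - 3 * y) := by
    rw [Real.sqrt_eq_iff_eq_sq]
    · linear_combination 3 * h
    · nlinarith [mul_nonneg (sq_nonneg U) (sq_nonneg (1 - 3 * y))]
    · exact mul_nonneg hU.le (by linarith)
  have hy2 : 0 < 2 - 3 * y := by linarith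
  have hU2 : U ^ 2 = 8 / (y * (2 - 3 * y)) := by rw [eq_div_iff (by positivity), h]
  have h1 : U ^ 4 - 20 * U ^ 2 + 32 + U * (U ^ 2 - 8) * √(U ^ 2 - 24) =
      (U ^ 2) ^ 2 - 20 * U ^ 2 + 32 + U ^ 2 * (U ^ 2 - 8) * (1 - 3 * y) := by rw [hs]; ring
  have h2 : U ^ 4 - 18 * U ^ 2 + U * (U ^ 2 - 6) * √(U ^ 2 - 24) =
      U ^ 2 * ((U ^ 2 - 18) + (U ^ 2 - 6) * (1 - 3 * y)) := by rw [hs]; ring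
  have h32 : 32 < U ^ 2 := by
    rw [hU2, lt_div_iff₀ (by positivity)]; nlinarith
  have hd : 0 < U ^ 2 * ((U ^ 2 - 18) + (U ^ 2 - 6) * (1 - 3 * y)) := by
    apply mul_pos (by linarith)
    have : 0 < (U ^ 2 - 6) * (1 - 3 * y) := mul_pos (by linarith) (by linarith)
    linarith
  rw [zeta, h1, h2, div_eq_div_iff hd.ne' hy2.ne']
  apply mul_left_cancel₀ (mul_ne_zero (pow_ne_zero 2 hy.ne') hy2.ne')
  linear_combination
    (y * (1 - 2 * y) * (U ^ 2 * (y * (2 - 3 * y))) - 4 * y ^ 2 * (2 - 3 * y) ^ 2) * h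

theorem exists_circular_param {U : ℝ} (hU : 4 * √2 < U) :
    ∃ y, 0 < y ∧ y < 1 / 6 ∧ U ^ 2 * (y * (2 - 3 * y)) = 8 := by
  have h2 : (√2) ^ 2 = 2 := Real.sq_sqrt (by norm_num)
  have h32 : 32 < U ^ 2 := by nlinarith [Real.sqrt_nonneg 2]
  have hx : 24 / U ^ 2 < 3 / 4 := by rw [div_lt_iff₀ (by linarith)]; linarith
  have hx0 : 0 < 24 / U ^ 2 := by positivity
  have hs := Real.sq_sqrt (show 0 ≤ 1 - 24 / U ^ 2 by linarith)
  have hs0 := Real.sqrt_nonneg (1 - 24 / U ^ 2)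
  refine ⟨(1 - √(1 - 24 / U ^ 2)) / 3, ?_, ?_, ?_⟩
  · nlinarith
  · nlinarith
  · have : (1 - √(1 - 24 / U ^ 2)) / 3 * (2 - 3 * ((1 - √(1 - 24 / U ^ 2)) / 3)) =
      8 / U ^ 2 := by linear_combination (-1 / 3) * hs
    rw [this, mul_div_cancel₀ _ (by linarith)]

/-- Surjectivity of `ζ`, so that the value of `Function.invFunOn` in `LE` is a true preimage. -/
theorem exists_zeta_eq {e : ℝ} (he : e ∈ Ioo (25 / 27 : ℝ) 1) :
    ∃ U ∈ Ioi (4 * √2), zeta U = e := by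
  have hc : ContinuousOn (fun y : ℝ => 2 * (1 - y) ^ 2 / (2 - 3 * y)) (Icc 0 (1 / 6)) := by
    apply ContinuousOn.div (by fun_prop) (by fun_prop)
    intro y hy
    have := hy.2
    linarith
  obtain ⟨y, ⟨hy, hy'⟩, h⟩ := intermediate_value_Ioo' (by norm_num : (0 : ℝ) ≤ 1 / 6) hc
    (by norm_num; exact he : e ∈ _)
  have hσ : 0 < y * (2 - 3 * y) := mul_pos hy (by linarith)
  refine ⟨√(8 / (y * (2 - 3 * y))), ?_, ?_⟩
  · rw [mem_Ioi]
    apply Real.lt_sqrt_of_sq_lt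
    rw [mul_pow, Real.sq_sqrt (by norm_num), lt_div_iff₀ hσ]
    nlinarith
  · rw [zeta_eq (Real.sqrt_pos.2 (by positivity)) hy hy' ?_]
    · exact h
    · rw [Real.sq_sqrt (by positivity), div_mul_cancel₀ _ hσ.ne']

/-- For `4M < L < L_E` the energy lies strictly between the minimum and the maximum of the potential
well, hence there are two turning points around `r₀`. -/
theorem exists_isTurningPair {M E L : ℝ} (hM : 0 < M) (hE : E ∈ Ioo (√(25 / 27)) 1)
    (hL : L ∈ Ioo (4 * M) (LE M E)) : ∃ a b, IsTurningPair (1 - E ^ 2) (4 * M ^ 2 / L ^ 2) a b := by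
  have hE0 : 0 < E := (Real.sqrt_nonneg _).trans_lt hE.1
  have hE2 : E ^ 2 ∈ Ioo (25 / 27 : ℝ) 1 := ⟨(Real.sqrt_lt' hE0).1 hE.1, by nlinarith [hE.2]⟩
  have hex := exists_zeta_eq hE2
  have hVm := Function.invFunOn_mem hex
  have hVe := Function.invFunOn_eq hex
  have hLV := hL.2
  rw [LE] at hLV
  set V := Function.invFunOn zeta (Ioi (4 * √2)) (E ^ 2)
  have h2 : 0 < √2 := by positivity
  have h22 : (√2) ^ 2 = 2 := Real.sq_sqrt (by norm_num)
  have hL0 : 0 < L := by linarith [hL.1]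
  have hUV : √2 * L / M < V := by
    rw [div_lt_iff₀ hM]
    rw [div_mul_eq_mul_div, lt_div_iff₀ h2] at hLV
    linarith
  have hU : 4 * √2 < √2 * L / M := by
    rw [lt_div_iff₀ hM]
    nlinarith [hL.1]
  obtain ⟨y, hy, hy', hyU⟩ := exists_circular_param hU
  obtain ⟨z, hz, hz', hzV⟩ := exists_circular_param hVm
  have hV0 : 0 < V := lt_trans (by positivity) (mem_Ioi.1 hVm)
  rw [zeta_eq hV0 hz hz' hzV, div_eq_iff (by linarith)] at hVe
  have hsq : (√2 * L / M) ^ 2 < V ^ 2 := by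
    have : 0 < √2 * L / M := by positivity
    nlinarith
  have hzy : z < y := by
    by_contra hcon
    push Not at hcon
    have h1 : y * (2 - 3 * y) ≤ z * (2 - 3 * z) := by nlinarith
    have h3 : 0 < y * (2 - 3 * y) := mul_pos hy (by linarith)
    have h4 : (√2 * L / M) ^ 2 * (y * (2 - 3 * y)) < V ^ 2 * (z * (2 - 3 * z)) :=
      mul_lt_mul hsq h1 h3 (by positivity)
    linarith
  have hκ : (1 - E ^ 2) * (2 - 3 * z) = z * (1 - 2 * z) := by linear_combination hVe
  have hσ : 4 * M ^ 2 / L ^ 2 = y * (2 - 3 * y) := by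
    rw [div_pow, mul_pow, h22, div_mul_eq_mul_div, div_eq_iff (by positivity)] at hyU
    rw [div_eq_iff (by positivity)]
    linear_combination -(1 / 2) * hyU
  rw [hσ]
  refine IsTurningPair.exists_of_peak_pos (by linarith [hE2.2]) hy hy' ?_
  have hz2 : 0 < 2 - 3 * z := by linarith
  have : 0 < (y * (1 - 2 * y) - (1 - E ^ 2) * (2 - 3 * y)) * (2 - 3 * z) := by
    have : (y * (1 - 2 * y) - (1 - E ^ 2) * (2 - 3 * y)) * (2 - 3 * z) =
        (y - z) * (2 - 4 * (y + z) + 6 * y * z) := by linear_combination -(2 - 3 * y) * hκ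
    rw [this]
    exact mul_pos (by linarith) (by nlinarith [mul_pos hy hz])
  linarith [pos_of_mul_pos_left this hz2.le]

/-! ### The apsidal angle as a regular integral -/

/-- The value of `u = 2M/r` at anomaly `t`: it oscillates between the turning values `a` and `b`. -/
def radial (a b t : ℝ) : ℝ := (a + b) / 2 - (b - a) / 2 * cos t

/-- The distance from `radial a b t` to the third root `1 - a - b` of the cubic. -/
def gap (a b t : ℝ) : ℝ := 1 - a - b - radial a b t

/-- The azimuth swept during one radial oscillation, written in the anomaly. -/
def apsidalIntegral (a b : ℝ) : ℝ := ∫ t in 0..2 * π, (√(gap a b t))⁻¹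

theorem hasDerivAt_radial (a b t : ℝ) : HasDerivAt (radial a b) ((b - a) / 2 * sin t) t := by
  have := ((hasDerivAt_cos t).const_mul ((b - a) / 2)).const_sub ((a + b) / 2)
  rwa [mul_neg, neg_neg] at this

theorem continuous_gap (a b : ℝ) : Continuous (gap a b) := by
  unfold gap radial; fun_prop

namespace IsTurningPair

variable {κ σ a b : ℝ}

theorem le_radial (h : IsTurningPair κ σ a b) (t : ℝ) : a ≤ radial a b t := by
  have h1 := cos_le_one t
  have h2 := h.lt
  unfold radial
  nlinarith

theorem radial_le (h : IsTurningPair κ σ a b) (t : ℝ) : radial a b t ≤ b := by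
  have h1 := neg_one_le_cos t
  have h2 := h.lt
  unfold radial
  nlinarith

theorem radial_pos (h : IsTurningPair κ σ a b) (t : ℝ) : 0 < radial a b t :=
  h.pos.trans_le (h.le_radial t)

theorem lt_one (h : IsTurningPair κ σ a b) : b < 1 := by
  linarith [h.pos, h.lt, h.lt_third]

theorem gap_pos (h : IsTurningPair κ σ a b) (t : ℝ) : 0 < gap a b t := by
  have := h.radial_le t
  have := h.lt_third
  unfold gap
  linarith

theorem cubic_radial (h : IsTurningPair κ σ a b) (t : ℝ) :
    radial a b t ^ 3 - radial a b t ^ 2 + σ * (radial a b t - κ) =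
      ((b - a) / 2) ^ 2 * sin t ^ 2 * gap a b t := by
  rw [h.cubic_eq, sin_sq]
  unfold gap radial
  ring

theorem strictMonoOn_radial (h : IsTurningPair κ σ a b) : StrictMonoOn (radial a b) (Icc 0 π) := by
  intro s hs t ht hst
  have h1 := strictAntiOn_cos hs ht hst
  have h2 := h.lt
  unfold radial
  nlinarith

theorem radial_image (h : IsTurningPair κ σ a b) : radial a b '' Ioo 0 π = Ioo a b := by
  have h0 : radial a b 0 = a := by simp [radial]; ring
  have h1 : radial a b π = b := by simp [radial]; ring
  apply Subset.antisymm
  · rintro _ ⟨t, ht, rfl⟩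
    constructor
    · exact h0.symm.trans_lt
        (h.strictMonoOn_radial ⟨le_rfl, pi_pos.le⟩ ⟨ht.1.le, ht.2.le⟩ ht.1)
    · exact (h.strictMonoOn_radial ⟨ht.1.le, ht.2.le⟩ ⟨pi_pos.le, le_rfl⟩ ht.2).trans_eq h1
  · have := intermediate_value_Ioo pi_pos.le
      (f := radial a b) (fun t _ => (hasDerivAt_radial a b t).continuousAt.continuousWithinAt)
    rwa [h0, h1] at this

variable {M E L : ℝ}

theorem energy_sub_W (hM : 0 < M) (hL : 0 < L)
    (h : IsTurningPair (1 - E ^ 2) (4 * M ^ 2 / L ^ 2) a b) (u : ℝ) :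
    E ^ 2 / 2 - W M (-1 / 2) L (2 * M / u) =
      (u - a) * (u - b) * (u - (1 - a - b)) * (L ^ 2 / (8 * M ^ 2)) := by
  rw [← h.cubic_eq, W, alpha]
  field_simp
  ring

theorem W_eq_iff (hM : 0 < M) (hL : 0 < L)
    (h : IsTurningPair (1 - E ^ 2) (4 * M ^ 2 / L ^ 2) a b) (r : ℝ) :
    W M (-1 / 2) L r = E ^ 2 / 2 ↔
      2 * M / r = a ∨ 2 * M / r = b ∨ 2 * M / r = 1 - a - b := by
  have := h.energy_sub_W hM hL (2 * M / r)
  have hLM : L ^ 2 / (8 * M ^ 2) ≠ 0 := by positivity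
  rw [div_div_cancel₀ (by positivity)] at this
  rw [eq_comm, ← sub_eq_zero, this]
  simp only [mul_eq_zero, hLM, or_false, sub_eq_zero, or_assoc]

/-- The minimum point `r₀` lies between the turning points: the derivative of the cubic is positive at
`a` and negative at `b`, and `v = 2M/r₀` is the smaller of its zeros `v` and `2/3 - v`. -/
theorem rZero_mem (hM : 0 < M) (hL : 0 < L)
    (h : IsTurningPair (1 - E ^ 2) (4 * M ^ 2 / L ^ 2) a b) :
    rZero M (-1 / 2) L ∈ Ioo (2 * M / b) (2 * M / a) := by
  have ha := h.pos
  have hb := h.pos.trans h.lt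
  have h1 := h.lt
  have h2 := h.lt_third
  have hσ : 4 * M ^ 2 / L ^ 2 * 3 < 1 := by
    rw [← h.sum_mul]; nlinarith [sq_pos_of_pos (sub_pos.2 h1)]
  have hLM : 12 * M ^ 2 < L ^ 2 := by
    rw [div_mul_eq_mul_div, div_lt_one (by positivity)] at hσ; linarith
  have hr : rZero M (-1 / 2) L = (L ^ 2 + L * √(L ^ 2 - 12 * M ^ 2)) / (2 * M) := by
    rw [rZero]; congr 1 <;> ring_nf
  set R := √(L ^ 2 - 12 * M ^ 2)
  have hR : R ^ 2 = L ^ 2 - 12 * M ^ 2 := Real.sq_sqrt (by linarith)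
  have hR0 : 0 ≤ R := Real.sqrt_nonneg _
  obtain ⟨v, hv⟩ : ∃ v, v = (L - R) / (3 * L) := ⟨_, rfl⟩
  have hvL : L - R = 3 * L * v := by rw [hv]; field_simp
  have hRL : R = L * (1 - 3 * v) := by linear_combination -hvL
  have hv3 : v ≤ 1 / 3 := by
    by_contra hc
    push Not at hc
    nlinarith
  have hσv : 4 * M ^ 2 / L ^ 2 = 2 * v - 3 * v ^ 2 := by
    rw [div_eq_iff (by positivity)]
    rw [hRL] at hR
    linear_combination (1 / 3) * hR
  have hv0 : 0 < v := by
    have : 0 < 2 * v - 3 * v ^ 2 := by rw [← hσv]; positivity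
    nlinarith
  have hrv : rZero M (-1 / 2) L = 2 * M / v := by
    rw [hr, div_eq_div_iff (by positivity) (by positivity), hRL]
    have : 4 * M ^ 2 = (2 * v - 3 * v ^ 2) * L ^ 2 := by rw [← hσv]; field_simp
    linear_combination -this
  have hs := h.sum_mul
  rw [hσv] at hs
  have ea : 3 * (a - v) * (a - (2 / 3 - v)) = (b - a) * (1 - a - b - a) := by
    linear_combination -hs
  have eb : 3 * (b - v) * ((2 / 3 - v) - b) = (b - a) * (1 - a - b - b) := by
    linear_combination hs
  have pa : 0 < (b - a) * (1 - a - b - a) := mul_pos (by linarith) (by linarith)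
  have pb : 0 < (b - a) * (1 - a - b - b) := mul_pos (by linarith) (by linarith)
  have hvb : v < b ∧ b < 2 / 3 - v := by
    constructor
    · by_contra hc
      push Not at hc
      nlinarith
    · by_contra hc
      push Not at hc
      nlinarith
  have hav : a < v := by
    by_contra hc
    push Not at hc
    nlinarith
  rw [hrv]
  exact ⟨div_lt_div_of_pos_left (by positivity) hv0 hvb.1,
    div_lt_div_of_pos_left (by positivity) ha hav⟩

theorem rPlus_eq (hM : 0 < M) (hL : 0 < L)
    (h : IsTurningPair (1 - E ^ 2) (4 * M ^ 2 / L ^ 2) a b) :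
    rPlus M E (-1 / 2) L = 2 * M / a := by
  have hr := h.rZero_mem hM hL
  have ha := h.pos
  have hb := h.pos.trans h.lt
  have hb' : 0 < 2 * M / b := by positivity
  refine IsLeast.csInf_eq ⟨⟨hr.2, ?_⟩, ?_⟩
  · rw [h.W_eq_iff hM hL]
    left; rw [div_div_cancel₀ (by positivity)]
  · rintro r ⟨hr1, hr2⟩
    have hr0 : 0 < r := hb'.trans (hr.1.trans hr1)
    rw [h.W_eq_iff hM hL] at hr2
    have hlt : 2 * M / r < b := by
      rw [div_lt_comm₀ hr0 hb]; exact hr.1.trans hr1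
    rcases hr2 with h' | h' | h'
    · rw [← h', div_div_cancel₀ (by positivity)]
    · linarith
    · linarith [h.lt_third]

theorem rMinus_eq (hM : 0 < M) (hL : 0 < L)
    (h : IsTurningPair (1 - E ^ 2) (4 * M ^ 2 / L ^ 2) a b) :
    rMinus M E (-1 / 2) L = 2 * M / b := by
  have hr := h.rZero_mem hM hL
  have ha := h.pos
  have hb := h.pos.trans h.lt
  have hb' : 0 < 2 * M / b := by positivity
  refine IsGreatest.csSup_eq ⟨⟨⟨?_, hr.1⟩, ?_⟩, ?_⟩
  · rw [lt_div_iff₀ hb]; nlinarith [h.lt_one]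
  · rw [h.W_eq_iff hM hL]
    right; left; rw [div_div_cancel₀ (by positivity)]
  · rintro r ⟨⟨hr0, hr1⟩, hr2⟩
    have hr0 : 0 < r := by linarith
    rw [h.W_eq_iff hM hL] at hr2
    have hlt : a < 2 * M / r := by
      rw [lt_div_comm₀ ha hr0]; exact hr1.trans hr.2
    rw [le_div_comm₀ hr0 hb]
    rcases hr2 with h' | h' | h'
    · linarith
    · exact h'.ge
    · rw [h']; exact h.lt_third.le

/-- Ingoing and outgoing halves of an oscillation sweep the same azimuth. -/
theorem apsidalIntegral_eq_two_mul (h : IsTurningPair κ σ a b) :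
    apsidalIntegral a b = 2 * ∫ t in 0..π, (√(gap a b t))⁻¹ := by
  have hc : Continuous fun t => (√(gap a b t))⁻¹ :=
    (continuous_gap a b).sqrt.inv₀ fun t => (Real.sqrt_pos.2 (h.gap_pos t)).ne'
  have hi := fun s t => hc.intervalIntegrable (μ := volume) s t
  have hr : ∫ t in π..2 * π, (√(gap a b t))⁻¹ = ∫ t in 0..π, (√(gap a b t))⁻¹ := by
    have := intervalIntegral.integral_comp_sub_left (fun t => (√(gap a b t))⁻¹) (2 * π)
      (a := 0) (b := π)
    rw [show 2 * π - π = π by ring, sub_zero] at this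
    rw [← this]
    refine intervalIntegral.integral_congr fun t _ => ?_
    simp only [gap, radial, cos_two_pi_sub]
  rw [apsidalIntegral, ← intervalIntegral.integral_add_adjacent_intervals (hi 0 π) (hi π _), hr]
  ring

/-- The substitution `x = radial a b t / (2M)` removes the inverse square root singularities of the
apsidal integral at both turning points. -/
theorem Theta_eq (hM : 0 < M) (hL : 0 < L)
    (h : IsTurningPair (1 - E ^ 2) (4 * M ^ 2 / L ^ 2) a b) :
    Theta M E (-1 / 2) L = apsidalIntegral a b := by
  have ha := h.pos
  have hb := h.pos.trans h.lt
  have hab := h.lt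
  rw [Theta, h.rPlus_eq hM hL, h.rMinus_eq hM hL, one_div_div, one_div_div,
    h.apsidalIntegral_eq_two_mul,
    intervalIntegral.integral_of_le (div_le_div_of_nonneg_right h.lt.le (by positivity)),
    integral_Ioc_eq_integral_Ioo, intervalIntegral.integral_of_le pi_pos.le,
    integral_Ioc_eq_integral_Ioo]
  have him : Ioo (a / (2 * M)) (b / (2 * M)) = (fun t => radial a b t / (2 * M)) '' Ioo 0 π := by
    have : (fun t => radial a b t / (2 * M)) = (fun u => u * (2 * M)⁻¹) ∘ radial a b := rfl
    rw [this, image_comp, h.radial_image, image_mul_right_Ioo _ _ (by positivity)]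
    simp only [div_eq_mul_inv]
  have hinj : InjOn (fun t => radial a b t / (2 * M)) (Ioo 0 π) := by
    intro s hs t ht hst
    exact (h.strictMonoOn_radial.mono Ioo_subset_Icc_self).injOn hs ht
      ((div_left_inj' (by positivity)).1 hst)
  rw [him, integral_image_eq_integral_abs_deriv_smul measurableSet_Ioo
    (fun t _ => ((hasDerivAt_radial a b t).div_const _).hasDerivWithinAt) hinj,
    ← integral_const_mul, ← integral_const_mul]
  refine setIntegral_congr_fun measurableSet_Ioo fun t ht => ?_
  have hs := sin_pos_of_pos_of_lt_pi ht.1 ht.2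
  have hg := h.gap_pos t
  have hg' := Real.sqrt_pos.2 hg
  have hu := h.radial_pos t
  have hd : 0 < b - a := sub_pos.2 hab
  have hW : E ^ 2 / 2 - W M (-1 / 2) L (1 / (radial a b t / (2 * M))) =
      2 * ((b - a) / 2 * sin t * √(gap a b t) * (L / (4 * M))) ^ 2 := by
    rw [one_div_div, h.energy_sub_W hM hL, ← h.cubic_eq, h.cubic_radial]
    simp only [mul_pow, Real.sq_sqrt hg.le]
    ring
  simp only [smul_eq_mul]
  rw [hW, Real.sqrt_mul (by norm_num), Real.sqrt_sq (by positivity), abs_of_pos (by positivity)]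
  field_simp
  norm_num

end IsTurningPair

/-! ### Monotonicity of the apsidal angle -/

/-- The complete elliptic integral `∫₀^{2π} (1 + k cos t)^{-1/2} dt`. -/
def periodIntegral (k : ℝ) : ℝ := ∫ t in 0..2 * π, (√(1 + k * cos t))⁻¹

theorem one_sub_le_one_add_mul_cos {k m : ℝ} (hk : |k| ≤ m) (t : ℝ) : 1 - m ≤ 1 + k * cos t := by
  have h1 : |k * cos t| ≤ m := by
    rw [abs_mul]
    exact (mul_le_of_le_one_right (abs_nonneg _) (abs_cos_le_one t)).trans hk
  linarith [neg_le_of_abs_le h1]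

theorem one_add_mul_cos_pos {k : ℝ} (hk : |k| < 1) (t : ℝ) : 0 < 1 + k * cos t :=
  (sub_pos.2 hk).trans_le (one_sub_le_one_add_mul_cos le_rfl t)

theorem periodIntegral_pos {k : ℝ} (hk : |k| < 1) : 0 < periodIntegral k := by
  have hc : Continuous fun t => (√(1 + k * cos t))⁻¹ :=
    Continuous.inv₀ (by fun_prop) fun t => (Real.sqrt_pos.2 (one_add_mul_cos_pos hk t)).ne'
  exact intervalIntegral.intervalIntegral_pos_of_pos (hc.intervalIntegrable _ _)
    (fun t => inv_pos.2 (Real.sqrt_pos.2 (one_add_mul_cos_pos hk t))) two_pi_pos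

/-- The derivative is `-½ ∫ cos t (1 + k cos t)^{-3/2} dt`. It is nonnegative since
`cos t (1 + k cos t)^{-3/2} ≤ cos t` for every `t`, and the integral of `cos` vanishes. -/
theorem exists_hasDerivAt_periodIntegral {k : ℝ} (hk0 : 0 ≤ k) (hk1 : k < 1) :
    ∃ d, 0 ≤ d ∧ HasDerivAt periodIntegral d k := by
  obtain ⟨m, hkm, hm1⟩ := exists_between hk1
  have hm0 : 0 < 1 - m := sub_pos.2 hm1
  have hpos : ∀ x ∈ Ioo (-m) m, ∀ t, 1 - m ≤ 1 + x * cos t := fun x hx t =>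
    one_sub_le_one_add_mul_cos (abs_le.2 ⟨hx.1.le, hx.2.le⟩) t
  have hks : k ∈ Ioo (-m) m := ⟨by linarith, hkm⟩
  have hwk : ∀ t, 0 < 1 + k * cos t := fun t => hm0.trans_le (hpos k hks t)
  have hF : ∀ x ∈ Ioo (-m) m, Continuous fun t => (√(1 + x * cos t))⁻¹ := fun x hx =>
    Continuous.inv₀ (by fun_prop) fun t => (Real.sqrt_pos.2 (hm0.trans_le (hpos x hx t))).ne'
  have hF' : Continuous fun t => -(cos t / (2 * √(1 + k * cos t))) / √(1 + k * cos t) ^ 2 := by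
    have hs : ∀ t, √(1 + k * cos t) ≠ 0 := fun t => (Real.sqrt_pos.2 (hwk t)).ne'
    refine Continuous.div (Continuous.neg (Continuous.div (by fun_prop) (by fun_prop) fun t =>
      mul_ne_zero two_ne_zero (hs t))) (by fun_prop) fun t => pow_ne_zero 2 (hs t)
  have key := intervalIntegral.hasDerivAt_integral_of_dominated_loc_of_deriv_le
    (μ := volume) (a := 0) (b := 2 * π) (F := fun x t => (√(1 + x * cos t))⁻¹)
    (F' := fun x t => -(cos t / (2 * √(1 + x * cos t))) / √(1 + x * cos t) ^ 2)
    (bound := fun _ => 1 / (2 * √(1 - m)) / √(1 - m) ^ 2)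
    (Ioo_mem_nhds hks.1 hks.2)
    (by
      filter_upwards [Ioo_mem_nhds hks.1 hks.2] with x hx
      exact (hF x hx).aestronglyMeasurable)
    ((hF k hks).intervalIntegrable _ _) hF'.aestronglyMeasurable
    (by
      refine ae_of_all _ fun t _ x hx => ?_
      have h0 := Real.sqrt_pos.2 hm0
      have h1 : √(1 - m) ≤ √(1 + x * cos t) := Real.sqrt_le_sqrt (hpos x hx t)
      have h2 : 0 < √(1 + x * cos t) := h0.trans_le h1
      rw [norm_div, norm_neg, norm_div, norm_of_nonneg (sq_nonneg _),
        norm_of_nonneg (by positivity : 0 ≤ 2 * √(1 + x * cos t)), Real.norm_eq_abs]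
      gcongr
      exact abs_cos_le_one t)
    intervalIntegrable_const
    (by
      refine ae_of_all _ fun t _ x hx => ?_
      have hw := hm0.trans_le (hpos x hx t)
      have h1 : HasDerivAt (fun x => 1 + x * cos t) (cos t) x := by
        simpa using ((hasDerivAt_id x).mul_const (cos t)).const_add 1
      exact (h1.sqrt hw.ne').inv (Real.sqrt_pos.2 hw).ne')
  refine ⟨_, ?_, key.2⟩
  have hle : ∫ t in 0..2 * π, -(cos t / 2) ≤
      ∫ t in 0..2 * π, -(cos t / (2 * √(1 + k * cos t))) / √(1 + k * cos t) ^ 2 := by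
    refine intervalIntegral.integral_mono two_pi_pos.le
      (Continuous.intervalIntegrable (by fun_prop) _ _) key.1 fun t => ?_
    have hs := Real.sqrt_pos.2 (hwk t)
    have he : -(cos t / (2 * √(1 + k * cos t))) / √(1 + k * cos t) ^ 2 =
        -(cos t / 2) / √(1 + k * cos t) ^ 3 := by field_simp
    beta_reduce
    rw [he, le_div_iff₀ (by positivity)]
    rcases le_total 0 (cos t) with hcos | hcos
    · have : 1 ≤ √(1 + k * cos t) ^ 3 := one_le_pow₀ (Real.one_le_sqrt.2 (by nlinarith))
      nlinarith
    · have : √(1 + k * cos t) ^ 3 ≤ 1 :=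
        pow_le_one₀ hs.le (Real.sqrt_le_one.2 (by nlinarith))
      nlinarith
  have h0 : ∫ t in 0..2 * π, -(cos t / 2) = 0 := by
    simp [intervalIntegral.integral_div]
  exact h0.symm.trans_le hle

namespace IsTurningPair

variable {κ σ a b : ℝ}

theorem apsidalIntegral_eq (h : IsTurningPair κ σ a b) :
    apsidalIntegral a b = (√(1 - 3 / 2 * (a + b)))⁻¹ *
      periodIntegral ((b - a) / 2 / (1 - 3 / 2 * (a + b))) := by
  have hA : 0 < 1 - 3 / 2 * (a + b) := by linarith [h.lt, h.lt_third]
  rw [apsidalIntegral, periodIntegral, ← intervalIntegral.integral_const_mul]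
  refine intervalIntegral.integral_congr fun t _ => ?_
  have : gap a b t = (1 - 3 / 2 * (a + b)) *
      (1 + (b - a) / 2 / (1 - 3 / 2 * (a + b)) * cos t) := by
    rw [mul_add, ← mul_assoc, mul_div_cancel₀ _ hA.ne']
    unfold gap radial
    ring
  change (√(gap a b t))⁻¹ = _
  rw [this, Real.sqrt_mul hA.le, mul_inv]

/-- A simple root of the cubic depends differentiably on `σ`: on the roots,
`σ = (u² - u³)/(u - κ)`, and this function of `u` is inverted locally. -/
theorem exists_hasDerivAt_root {v : ℝ} (hv : κ < v)
    (hp : v ^ 3 - v ^ 2 + σ * (v - κ) = 0) (hp' : 3 * v ^ 2 - 2 * v + σ ≠ 0) :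
    ∃ f : ℝ → ℝ, f σ = v ∧ HasDerivAt f (-(v - κ) / (3 * v ^ 2 - 2 * v + σ)) σ ∧
      ∀ᶠ s in 𝓝 σ, f s ^ 3 - f s ^ 2 + s * (f s - κ) = 0 := by
  have hvk : v - κ ≠ 0 := (sub_pos.2 hv).ne'
  have hσ : σ = (v ^ 2 - v ^ 3) / (v - κ) := by
    rw [eq_div_iff hvk]; linear_combination hp
  have hd : HasStrictDerivAt (fun u => (u ^ 2 - u ^ 3) / (u - κ))
      (-(3 * v ^ 2 - 2 * v + σ) / (v - κ)) v := by
    have h1 : HasStrictDerivAt (fun u : ℝ => u ^ 2 - u ^ 3) (2 * v - 3 * v ^ 2) v := by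
      exact ((hasStrictDerivAt_pow 2 v).sub (hasStrictDerivAt_pow 3 v)).congr_deriv (by norm_num)
    have h2 : HasStrictDerivAt (fun u : ℝ => u - κ) 1 v := (hasStrictDerivAt_id v).sub_const κ
    refine (h1.div h2 hvk).congr_deriv ?_
    rw [div_eq_div_iff (pow_ne_zero 2 hvk) hvk]
    linear_combination (v - κ) * hp
  have hd0 : -(3 * v ^ 2 - 2 * v + σ) / (v - κ) ≠ 0 := div_ne_zero (neg_ne_zero.2 hp') hvk
  have hg := (hd.to_localInverse hd0).hasDerivAt
  have hev := hd.eventually_right_inverse hd0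
  have hfv := (hd.hasStrictFDerivAt_equiv hd0).localInverse_apply_image
  set f := hd.localInverse _ _ _ hd0
  change f ((v ^ 2 - v ^ 3) / (v - κ)) = v at hfv
  rw [← hσ] at hg hev hfv
  refine ⟨f, hfv, ?_, ?_⟩
  · refine hg.congr_deriv ?_
    rw [inv_div, neg_div, div_neg]
  · have hlt : ∀ᶠ s in 𝓝 σ, κ < f s :=
      hg.continuousAt.eventually (lt_mem_nhds (by rw [hfv]; exact hv))
    filter_upwards [hev, hlt] with s hs hs'
    rw [div_eq_iff (sub_pos.2 hs').ne'] at hs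
    linear_combination -hs

/-- Along the turning pairs with fixed `κ`, the apsidal integral is near `σ` a function of the
parameter with positive derivative. -/
theorem exists_deriv_apsidalIntegral_pos (h : IsTurningPair κ σ a b) :
    ∃ Φ : ℝ → ℝ, ∃ d, 0 < d ∧ HasDerivAt Φ d σ ∧
      ∀ᶠ s in 𝓝 σ, ∃ a' b', IsTurningPair κ s a' b' ∧ Φ s = apsidalIntegral a' b' := by
  have ha := h.pos
  have hab := h.lt
  have hbc := h.lt_third
  have hκ := h.kappa_lt
  have hpa := h.cubic_eq a
  have hpb := h.cubic_eq b
  have ea : 3 * a ^ 2 - 2 * a + σ = (b - a) * (1 - a - b - a) := by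
    linear_combination -h.sum_mul
  have eb : 3 * b ^ 2 - 2 * b + σ = -((b - a) * (1 - a - b - b)) := by
    linear_combination -h.sum_mul
  have pa : 0 < (b - a) * (1 - a - b - a) := mul_pos (by linarith) (by linarith)
  have pb : 0 < (b - a) * (1 - a - b - b) := mul_pos (by linarith) (by linarith)
  obtain ⟨f, hf, hfd, hfe⟩ := exists_hasDerivAt_root hκ (by rw [hpa]; ring)
    (by rw [ea]; exact pa.ne')
  obtain ⟨g, hg, hgd, hge⟩ := exists_hasDerivAt_root (hκ.trans hab) (by rw [hpb]; ring)
    (by rw [eb]; exact (neg_neg_of_pos pb).ne)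
  rw [ea] at hfd
  rw [eb, neg_div_neg_eq] at hgd
  set f' := -(a - κ) / ((b - a) * (1 - a - b - a)) with hf'
  set g' := (b - κ) / ((b - a) * (1 - a - b - b)) with hg'
  have hf0 : f' < 0 := div_neg_of_neg_of_pos (by linarith) pa
  have hg0 : 0 < g' := div_pos (by linarith) pb
  have hfg : 0 < f' + g' := by
    have : (a - κ) / ((b - a) * (1 - a - b - a)) < g' :=
      div_lt_div₀ (by linarith) (mul_le_mul_of_nonneg_left (by linarith) (by linarith))
        (by linarith) pb
    rw [hf', neg_div]
    linarith
  -- With `gap = A + B cos t`, the mean `A` decreases and the amplitude `B` increases with `σ`; both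
  -- changes enlarge the integral `A^{-1/2} · periodIntegral (B / A)`.
  have hA : HasDerivAt (fun s => 1 - 3 / 2 * (f s + g s)) (-(3 / 2 * (f' + g'))) σ :=
    ((hfd.add hgd).const_mul _).const_sub _
  have hB : HasDerivAt (fun s => (g s - f s) / 2) ((g' - f') / 2) σ := (hgd.sub hfd).div_const _
  have hA0 : 0 < 1 - 3 / 2 * (f σ + g σ) := by rw [hf, hg]; linarith
  have hk := hB.div hA hA0.ne'
  have hk0 : 0 ≤ (g σ - f σ) / 2 / (1 - 3 / 2 * (f σ + g σ)) :=
    div_nonneg (by rw [hf, hg]; linarith) hA0.le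
  have hk1 : (g σ - f σ) / 2 / (1 - 3 / 2 * (f σ + g σ)) < 1 := by
    rw [div_lt_one hA0, hf, hg]; linarith
  obtain ⟨e, he0, he⟩ := exists_hasDerivAt_periodIntegral hk0 hk1
  have hP := periodIntegral_pos (abs_lt.2 ⟨by linarith, hk1⟩)
  refine ⟨_, _, ?_, ((hA.sqrt hA0.ne').inv (Real.sqrt_pos.2 hA0).ne').mul (he.comp σ hk), ?_⟩
  · have hs := Real.sqrt_pos.2 hA0
    apply add_pos_of_pos_of_nonneg
    · apply mul_pos _ hP
      refine div_pos ?_ (pow_pos hs 2)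
      rw [neg_div, neg_neg]
      positivity
    · refine mul_nonneg (inv_nonneg.2 hs.le) ?_
      apply mul_nonneg he0
      apply div_nonneg _ (sq_nonneg _)
      have h1 : 0 ≤ (g' - f') / 2 * (1 - 3 / 2 * (f σ + g σ)) := mul_nonneg (by linarith) hA0.le
      have h2 : 0 ≤ (g σ - f σ) / 2 * (3 / 2 * (f' + g')) :=
        mul_nonneg (by rw [hf, hg]; linarith) (by linarith)
      linarith
  · have hfc := hfd.continuousAt
    have hgc := hgd.continuousAt
    have h1 : ∀ᶠ s in 𝓝 σ, 0 < f s := hfc.eventually (lt_mem_nhds (by rw [hf]; exact ha))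
    have h2 : ∀ᶠ s in 𝓝 σ, f s < g s := hfc.eventually_lt hgc (by rw [hf, hg]; exact hab)
    have h3 : ∀ᶠ s in 𝓝 σ, g s < 1 - f s - g s :=
      hgc.eventually_lt ((continuousAt_const.sub hfc).sub hgc) (by rw [hf, hg]; exact hbc)
    filter_upwards [hfe, hge, h1, h2, h3] with s s1 s2 s3 s4 s5
    have := of_roots s3 s4 s5 s1 s2
    exact ⟨f s, g s, this, this.apsidalIntegral_eq.symm⟩

end IsTurningPair

theorem exists_hasDerivAt_Theta {M E L : ℝ} (hM : 0 < M) (hL : 0 < L) {a b : ℝ}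
    (h : IsTurningPair (1 - E ^ 2) (4 * M ^ 2 / L ^ 2) a b) :
    ∃ d, d ≠ 0 ∧ HasDerivAt (fun l => Theta M E (-1 / 2) l) d L := by
  obtain ⟨Φ, d, hd, hΦ, hev⟩ := h.exists_deriv_apsidalIntegral_pos
  have hσ : HasDerivAt (fun l : ℝ => 4 * M ^ 2 / l ^ 2) (-(8 * M ^ 2 / L ^ 3)) L := by
    refine ((hasDerivAt_const L (4 * M ^ 2)).div (hasDerivAt_pow 2 L)
      (by positivity)).congr_deriv ?_
    field_simp
    norm_num
    ring
  refine ⟨_, mul_ne_zero hd.ne' (neg_ne_zero.2 (by positivity)),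
    (hΦ.comp L hσ).congr_of_eventuallyEq ?_⟩
  filter_upwards [hσ.continuousAt.eventually hev, lt_mem_nhds hL] with l ⟨a', b', hl, hl'⟩ hl0
  rw [hl.Theta_eq hM hl0, Function.comp_apply, hl']

/-! ### Autonomous equations on the line -/

theorem contDiff_two_of_hasDerivAt {f f' : ℝ → ℝ} (h : ∀ s, HasDerivAt f (f' s) s)
    (hf' : ContDiff ℝ 1 f') : ContDiff ℝ 2 f := by
  rw [show (2 : WithTop ℕ∞) = 1 + 1 by norm_num, contDiff_succ_iff_deriv,
    funext fun s => (h s).deriv]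
  exact ⟨fun s => (h s).differentiableAt, by simp, hf'⟩

/-- The equation `x' = G(x)` with `G` positive and periodic is solved by inverting
`t ↦ ∫₀ᵗ 1/G`. The solution runs through `ℝ` and advances by one period of `G` in constant time. -/
theorem exists_periodic_flow {G : ℝ → ℝ} {T : ℝ} (hT : 0 < T) (hG : ContDiff ℝ 1 G)
    (hpos : ∀ t, 0 < G t) (hper : Function.Periodic G T) :
    ∃ x : ℝ → ℝ, ContDiff ℝ 2 x ∧ Function.Surjective x ∧ (∀ s, HasDerivAt x (G (x s)) s) ∧
      ∃ P, 0 < P ∧ ∀ s, x (s + P) = x s + T := by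
  have hc : Continuous fun t => (G t)⁻¹ := hG.continuous.inv₀ fun t => (hpos t).ne'
  have hi : ∀ t₁ t₂, IntervalIntegrable (fun t => (G t)⁻¹) volume t₁ t₂ :=
    fun t₁ t₂ => hc.intervalIntegrable t₁ t₂
  have hper' : Function.Periodic (fun t => (G t)⁻¹) T := fun t => by simp only [hper t]
  have hpos' : ∀ t, 0 < (G t)⁻¹ := fun t => inv_pos.2 (hpos t)
  set S : ℝ → ℝ := fun t => ∫ u in 0..t, (G u)⁻¹ with hS
  have hd : ∀ t, HasDerivAt S (G t)⁻¹ t := fun t =>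
    intervalIntegral.integral_hasDerivAt_right (hi 0 t)
      (hc.stronglyMeasurableAtFilter _ _) hc.continuousAt
  have hcS : Continuous S := continuous_iff_continuousAt.2 fun t => (hd t).continuousAt
  have hmono : StrictMono S := strictMono_of_hasDerivAt_pos hd hpos'
  have hsurj : Function.Surjective S := hcS.surjective
    (hper'.tendsto_atTop_intervalIntegral_of_pos' (hi 0 T) hpos' hT)
    (hper'.tendsto_atBot_intervalIntegral_of_pos' (hi 0 T) hpos' hT)
  set e := hmono.orderIsoOfSurjective S hsurj
  have heS : ∀ t, e t = S t := fun t => rfl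
  have hSe : ∀ s, S (e.symm s) = s := fun s => by rw [← heS, e.apply_symm_apply]
  have hx : ∀ s, HasDerivAt e.symm (G (e.symm s)) s := fun s => by
    have := HasDerivAt.of_local_left_inverse e.symm.continuous.continuousAt (hd (e.symm s))
      (hpos' _).ne' (Eventually.of_forall hSe)
    rwa [inv_inv] at this
  have h1 : ContDiff ℝ 1 e.symm := by
    rw [contDiff_one_iff_deriv, funext fun s => (hx s).deriv]
    exact ⟨fun s => (hx s).differentiableAt, hG.continuous.comp e.symm.continuous⟩
  refine ⟨e.symm, contDiff_two_of_hasDerivAt hx (hG.comp h1), e.symm.surjective, hx, S T, ?_, fun s => ?_⟩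
  · exact intervalIntegral.intervalIntegral_pos_of_pos (hi 0 T) hpos' hT
  · apply hmono.injective
    rw [hSe, hS]
    have h2 := hper'.intervalIntegral_add_eq_add 0 (e.symm s) hi
    simp only [zero_add] at h2
    beta_reduce
    rw [h2]
    have h3 := hSe s
    rw [hS] at h3
    beta_reduce at h3
    rw [h3]

/-! ### Momenta and forces -/

theorem lagrangian_eq (M : ℝ) (q v : Fin 4 → ℝ) :
    lagrangian M q v = (1 / 2) * (-alpha M (q 1) * v 0 ^ 2 + (alpha M (q 1))⁻¹ * v 1 ^ 2 +
      q 1 ^ 2 * v 2 ^ 2 + q 1 ^ 2 * sin (q 2) ^ 2 * v 3 ^ 2) := by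
  simp [lagrangian, metric, Fin.sum_univ_four, Matrix.diagonal]
  ring

theorem hasDerivAt_quadratic (c d w : ℝ) :
    HasDerivAt (fun w : ℝ => 1 / 2 * (c * w ^ 2 + d)) (c * w) w := by
  have := (((hasDerivAt_pow 2 w).const_mul c).add_const d).const_mul (1 / 2)
  refine this.congr_deriv ?_
  norm_num
  ring

theorem momentum_eq (M : ℝ) (μ : Fin 4) (q v : Fin 4 → ℝ) :
    momentum M μ q v = ![-alpha M (q 1), (alpha M (q 1))⁻¹, q 1 ^ 2,
      q 1 ^ 2 * sin (q 2) ^ 2] μ * v μ := by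
  have key : ∀ c d, (∀ w, lagrangian M q (Function.update v μ w) = 1 / 2 * (c * w ^ 2 + d)) →
      momentum M μ q v = c * v μ := fun c d h => by
    rw [momentum, funext h, (hasDerivAt_quadratic c d (v μ)).deriv]
  fin_cases μ
  · refine key _ ((alpha M (q 1))⁻¹ * v 1 ^ 2 + q 1 ^ 2 * v 2 ^ 2 +
      q 1 ^ 2 * sin (q 2) ^ 2 * v 3 ^ 2) fun w => ?_
    simp [lagrangian_eq]; ring
  · refine key _ (-alpha M (q 1) * v 0 ^ 2 + q 1 ^ 2 * v 2 ^ 2 +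
      q 1 ^ 2 * sin (q 2) ^ 2 * v 3 ^ 2) fun w => ?_
    simp [lagrangian_eq]; ring
  · refine key _ (-alpha M (q 1) * v 0 ^ 2 + (alpha M (q 1))⁻¹ * v 1 ^ 2 +
      q 1 ^ 2 * sin (q 2) ^ 2 * v 3 ^ 2) fun w => ?_
    simp [lagrangian_eq]; ring
  · refine key _ (-alpha M (q 1) * v 0 ^ 2 + (alpha M (q 1))⁻¹ * v 1 ^ 2 +
      q 1 ^ 2 * v 2 ^ 2) fun w => ?_
    simp [lagrangian_eq]; ring

theorem force_time (M : ℝ) (q v : Fin 4 → ℝ) : force M 0 q v = 0 := by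
  simp [force, lagrangian_eq]

theorem force_azimuth (M : ℝ) (q v : Fin 4 → ℝ) : force M 3 q v = 0 := by
  simp [force, lagrangian_eq]

theorem force_colatitude (M : ℝ) {q : Fin 4 → ℝ} (v : Fin 4 → ℝ) (hq : q 2 = π / 2) :
    force M 2 q v = 0 := by
  have : (fun x => lagrangian M (Function.update q 2 x) v) = fun x =>
      (1 / 2) * (-alpha M (q 1) * v 0 ^ 2 + (alpha M (q 1))⁻¹ * v 1 ^ 2 +
      q 1 ^ 2 * v 2 ^ 2 + q 1 ^ 2 * sin x ^ 2 * v 3 ^ 2) := by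
    funext x; simp [lagrangian_eq]
  rw [force, this]
  refine HasDerivAt.deriv ?_
  have h := (((((hasDerivAt_sin (q 2)).pow 2).const_mul (q 1 ^ 2)).mul_const (v 3 ^ 2)).const_add
    (-alpha M (q 1) * v 0 ^ 2 + (alpha M (q 1))⁻¹ * v 1 ^ 2 + q 1 ^ 2 * v 2 ^ 2)).const_mul (1 / 2)
  refine h.congr_deriv ?_
  rw [hq, cos_pi_div_two]
  ring

theorem hasDerivAt_alpha (M : ℝ) {r : ℝ} (hr : r ≠ 0) :
    HasDerivAt (alpha M) (2 * M / r ^ 2) r := by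
  have := ((hasDerivAt_const r (2 * M)).div (hasDerivAt_id r) hr).const_sub 1
  refine this.congr_deriv ?_
  simp [neg_div]

theorem force_radial (M : ℝ) {q : Fin 4 → ℝ} (v : Fin 4 → ℝ) (hr : q 1 ≠ 0)
    (hα : alpha M (q 1) ≠ 0) (hq : q 2 = π / 2) :
    force M 1 q v = 1 / 2 * (-(2 * M / q 1 ^ 2) * v 0 ^ 2 -
      2 * M / q 1 ^ 2 / alpha M (q 1) ^ 2 * v 1 ^ 2 + 2 * q 1 * (v 2 ^ 2 + v 3 ^ 2)) := by
  have : (fun x => lagrangian M (Function.update q 1 x) v) = fun x =>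
      (1 / 2) * (-alpha M x * v 0 ^ 2 + (alpha M x)⁻¹ * v 1 ^ 2 +
      x ^ 2 * v 2 ^ 2 + x ^ 2 * v 3 ^ 2) := by
    funext x; simp [lagrangian_eq, hq]
  rw [force, this]
  refine HasDerivAt.deriv ?_
  have ha := hasDerivAt_alpha M hr
  have h2 := hasDerivAt_pow 2 (q 1)
  have h := ((((ha.neg.mul_const (v 0 ^ 2)).add ((ha.inv hα).mul_const (v 1 ^ 2))).add
    (h2.mul_const (v 2 ^ 2))).add (h2.mul_const (v 3 ^ 2))).const_mul (1 / 2)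
  refine h.congr_deriv ?_
  norm_num
  ring

/-! ### Closed orbits -/

theorem apply_add_nat_mul {f : ℝ → ℝ} {P c : ℝ} (h : ∀ s, f (s + P) = f s + c) (n : ℕ) (s : ℝ) :
    f (s + n * P) = f s + n * c := by
  induction n with
  | zero => simp
  | succ n ih =>
    rw [show s + ((n + 1 : ℕ) : ℝ) * P = s + n * P + P by push_cast; ring, h, ih]
    push_cast
    ring

theorem contDiff_radial (a b : ℝ) {n : WithTop ℕ∞} : ContDiff ℝ n (radial a b) := by
  unfold radial; fun_prop

theorem contDiff_gap (a b : ℝ) {n : WithTop ℕ∞} : ContDiff ℝ n (gap a b) :=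
  contDiff_const.sub (contDiff_radial a b)

theorem hasDerivAt_gap (a b t : ℝ) : HasDerivAt (gap a b) (-((b - a) / 2 * sin t)) t :=
  (hasDerivAt_radial a b t).const_sub _

theorem radial_periodic (a b : ℝ) : Function.Periodic (radial a b) (2 * π) := fun t => by
  simp only [radial, cos_add_two_pi]

theorem gap_periodic (a b : ℝ) : Function.Periodic (gap a b) (2 * π) := fun t => by
  simp only [gap, radial_periodic a b t]

theorem IsTurningPair.cubic_deriv_radial {κ σ a b : ℝ} (h : IsTurningPair κ σ a b) (t : ℝ) :
    3 * radial a b t ^ 2 - 2 * radial a b t + σ =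
      2 * ((b - a) / 2) * cos t * gap a b t - ((b - a) / 2) ^ 2 * sin t ^ 2 := by
  rw [← h.sum_mul, sin_sq]
  unfold gap radial
  ring

/-- The orbit of energy `E` and angular momentum `L` is written down explicitly. The anomaly `x`
solves `x' = L/(4M²) u² √gap`, which makes `r² φ' = L` for the azimuth `φ` with `dφ/dx = 1/√gap`.
If `d` oscillations sweep `n` full turns, the orbit closes up after `d` radial periods. -/
theorem exists_closed_geodesic {M E L a b : ℝ} (hM : 0 < M) (hL : 0 < L)
    (h : IsTurningPair (1 - E ^ 2) (4 * M ^ 2 / L ^ 2) a b) {d : ℕ} (hd : 0 < d) {n : ℤ}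
    (hn : d * apsidalIntegral a b = 2 * π * n) :
    ∃ q : ℝ → Fin 4 → ℝ, IsGeodesic M q ∧ IsEquatorial q ∧ IsTimelike M q ∧ ¬ IsCircular q ∧
      IsSpatiallyClosed q ∧ HasEnergy M E q ∧ HasAngularMomentum M L q := by
  have hg := h.gap_pos
  have hsg : ∀ t, 0 < √(gap a b t) := fun t => Real.sqrt_pos.2 (hg t)
  have hu := h.radial_pos
  have hsgc : ContDiff ℝ 1 fun t => √(gap a b t) := (contDiff_gap a b).sqrt fun t => (hg t).ne'
  obtain ⟨x, hxc, hxs, hx, P, hP, hxP⟩ := exists_periodic_flow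
    (G := fun t => L / (4 * M ^ 2) * radial a b t ^ 2 * √(gap a b t)) two_pi_pos
    ((contDiff_const.mul ((contDiff_radial a b).pow 2)).mul hsgc)
    (fun t => mul_pos (mul_pos (by positivity) (pow_pos (hu t) 2)) (hsg t))
    (fun t => by simp only [radial_periodic a b t, gap_periodic a b t])
  -- the azimuth `φ` as a function of the anomaly
  have hφc : Continuous fun t => (√(gap a b t))⁻¹ :=
    hsgc.continuous.inv₀ fun t => (hsg t).ne'
  have hφi : ∀ s t, IntervalIntegrable (fun t => (√(gap a b t))⁻¹) volume s t :=
    fun s t => hφc.intervalIntegrable s t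
  obtain ⟨φ, hφ⟩ : ∃ φ : ℝ → ℝ, φ = fun t => ∫ y in 0..t, (√(gap a b y))⁻¹ := ⟨_, rfl⟩
  have hφd : ∀ t, HasDerivAt φ (√(gap a b t))⁻¹ t := fun t => by
    rw [hφ]
    exact intervalIntegral.integral_hasDerivAt_right (hφi 0 t)
      (hφc.stronglyMeasurableAtFilter _ _) hφc.continuousAt
  have hφP : ∀ t, φ (t + 2 * π) = φ t + apsidalIntegral a b := fun t => by
    have hper : Function.Periodic (fun t => (√(gap a b t))⁻¹) (2 * π) := fun t => by
      simp only [gap_periodic a b t]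
    have := hper.intervalIntegral_add_eq_add 0 t hφi
    rw [hφ, apsidalIntegral]
    simpa using this
  -- `u = 2M/r` as a function of proper time
  obtain ⟨u, hudef⟩ : ∃ u : ℝ → ℝ, u = fun s => radial a b (x s) := ⟨_, rfl⟩
  have hus : ∀ s, radial a b (x s) = u s := fun s => by rw [hudef]
  have hu0 : ∀ s, 0 < u s := fun s => hus s ▸ hu (x s)
  have hu1 : ∀ s, u s < 1 := fun s => hus s ▸ (h.radial_le (x s)).trans_lt h.lt_one
  have hu1' : ∀ s, 1 - u s ≠ 0 := fun s => (sub_pos.2 (hu1 s)).ne'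
  have huc : ContDiff ℝ 2 u := hudef ▸ (contDiff_radial a b).comp hxc
  have huc1 : ContDiff ℝ 1 u := huc.of_le (by norm_num)
  have hud : ∀ s, HasDerivAt u ((b - a) / 2 * sin (x s) *
      (L / (4 * M ^ 2) * u s ^ 2 * √(gap a b (x s)))) s := fun s => by
    have := (hasDerivAt_radial a b (x s)).comp s (hx s)
    rw [hus] at this
    rwa [show radial a b ∘ x = u from hudef.symm] at this
  -- the time coordinate, from `-α τ' = E`
  have hτc : ContDiff ℝ 1 fun s => -E / (1 - u s) :=
    contDiff_const.div (contDiff_const.sub huc1) hu1'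
  obtain ⟨τ, hτ⟩ : ∃ τ : ℝ → ℝ, τ = fun t => ∫ y in 0..t, -E / (1 - u y) := ⟨_, rfl⟩
  have hτd : ∀ s, HasDerivAt τ (-E / (1 - u s)) s := fun s => by
    rw [hτ]
    exact intervalIntegral.integral_hasDerivAt_right (hτc.continuous.intervalIntegrable 0 s)
      (hτc.continuous.stronglyMeasurableAtFilter _ _) hτc.continuous.continuousAt
  have hrd : ∀ s, HasDerivAt (fun s => 2 * M / u s)
      (-(L / (2 * M)) * ((b - a) / 2 * (sin (x s) * √(gap a b (x s))))) s := fun s => by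
    refine ((hasDerivAt_const s (2 * M)).div (hud s) (hu0 s).ne').congr_deriv ?_
    have := (hu0 s).ne'
    field_simp
    ring
  have hφxd : ∀ s, HasDerivAt (fun s => φ (x s)) (L / (4 * M ^ 2) * u s ^ 2) s := fun s => by
    refine ((hφd (x s)).comp s (hx s)).congr_deriv ?_
    rw [hus]
    have := (hsg (x s)).ne'
    field_simp
  obtain ⟨q, hq⟩ : ∃ q : ℝ → Fin 4 → ℝ,
      q = fun s => ![τ s, 2 * M / u s, π / 2, φ (x s)] := ⟨_, rfl⟩
  have hq1 : ∀ s, q s 1 = 2 * M / u s := fun s => by rw [hq]; rfl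
  have hq2 : ∀ s, q s 2 = π / 2 := fun s => by rw [hq]; rfl
  have hq3 : ∀ s, q s 3 = φ (x s) := fun s => by rw [hq]; rfl
  have hα : ∀ s, alpha M (q s 1) = 1 - u s := fun s => by
    rw [hq1, alpha, div_div_cancel₀ (by positivity)]
  have hqd : ∀ s, deriv q s = ![-E / (1 - u s),
      -(L / (2 * M)) * ((b - a) / 2 * (sin (x s) * √(gap a b (x s)))), 0,
      L / (4 * M ^ 2) * u s ^ 2] := fun s => by
    refine HasDerivAt.deriv ?_
    rw [hq, hasDerivAt_pi]
    intro μ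
    fin_cases μ
    · exact hτd s
    · exact hrd s
    · exact hasDerivAt_const s _
    · exact hφxd s
  have hv0 : ∀ s, deriv q s 0 = -E / (1 - u s) := fun s => by rw [hqd]; rfl
  have hv1 : ∀ s, deriv q s 1 =
      -(L / (2 * M)) * ((b - a) / 2 * (sin (x s) * √(gap a b (x s)))) := fun s => by
    rw [hqd]; rfl
  have hv2 : ∀ s, deriv q s 2 = 0 := fun s => by rw [hqd]; rfl
  have hv3 : ∀ s, deriv q s 3 = L / (4 * M ^ 2) * u s ^ 2 := fun s => by rw [hqd]; rfl
  -- conservation of energy for the radial motion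
  have hv1sq : ∀ s, deriv q s 1 ^ 2 =
      E ^ 2 - (1 - u s) * (1 + L ^ 2 / (4 * M ^ 2) * u s ^ 2) := fun s => by
    have h1 : deriv q s 1 ^ 2 = L ^ 2 / (4 * M ^ 2) *
        (((b - a) / 2) ^ 2 * sin (x s) ^ 2 * gap a b (x s)) := by
      rw [hv1]
      simp only [mul_pow, Real.sq_sqrt (hg (x s)).le]
      field_simp
      ring
    rw [h1, ← h.cubic_radial, hus]
    field_simp
    ring
  -- The radial acceleration is computed from the parametrization: dividing the derivative of
  -- `hv1sq` by the radial velocity would lose the turning points.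
  have hv1d : ∀ s, HasDerivAt (fun s => deriv q s 1) (-(L ^ 2 * u s ^ 2 / (16 * M ^ 3)) *
      (3 * u s ^ 2 - 2 * u s + 4 * M ^ 2 / L ^ 2)) s := fun s => by
    rw [funext hv1]
    have h1 := ((((hasDerivAt_sin (x s)).mul ((hasDerivAt_gap a b (x s)).sqrt
      (hg (x s)).ne')).const_mul ((b - a) / 2)).const_mul (-(L / (2 * M)))).comp s (hx s)
    refine h1.congr_deriv ?_
    have h2 := h.cubic_deriv_radial (x s)
    have h3 := Real.sq_sqrt (hg (x s)).le
    have h4 := (hsg (x s)).ne'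
    rw [hus] at h2 ⊢
    rw [h2]
    set w := √(gap a b (x s))
    rw [← h3]
    field_simp
    ring
  have henergy : HasEnergy M E q := fun s => by
    have := hu1' s
    rw [momentum_eq, hα, hv0]
    change -(1 - u s) * (-E / (1 - u s)) = E
    rw [neg_mul, mul_div_cancel₀ _ this, neg_neg]
  have hangular : HasAngularMomentum M L q := fun s => by
    have := (hu0 s).ne'
    rw [momentum_eq, hq1, hq2, hv3, sin_pi_div_two]
    change (2 * M / u s) ^ 2 * 1 ^ 2 * (L / (4 * M ^ 2) * u s ^ 2) = L
    field_simp
    norm_num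
  refine ⟨q, ⟨?_, ?_, ?_, ?_⟩, hq2, ?_, ?_, ?_, henergy, hangular⟩
  · rw [contDiff_pi]
    intro μ
    rw [hq]
    fin_cases μ
    · exact contDiff_two_of_hasDerivAt hτd hτc
    · exact contDiff_const.div huc fun s => (hu0 s).ne'
    · exact contDiff_const
    · exact contDiff_two_of_hasDerivAt hφxd (contDiff_const.mul (huc1.pow 2))
  · intro s
    rw [hq1, lt_div_iff₀ (hu0 s)]
    nlinarith [hu1 s]
  · intro s
    rw [hq2]
    exact ⟨by positivity, by linarith [pi_pos]⟩
  · intro μ s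
    fin_cases μ
    · change HasDerivAt (fun s => momentum M 0 (q s) (deriv q s))
        (force M 0 (q s) (deriv q s)) s
      rw [funext henergy, force_time]
      exact hasDerivAt_const s E
    · change HasDerivAt (fun s => momentum M 1 (q s) (deriv q s))
        (force M 1 (q s) (deriv q s)) s
      have hr0 : q s 1 ≠ 0 := by
        rw [hq1]; exact (div_pos (by positivity) (hu0 s)).ne'
      rw [force_radial M _ hr0 (by rw [hα]; exact hu1' s) (hq2 s), hv2, hv0, hv3, hv1sq, hα, hq1]
      have hp : (fun s => momentum M 1 (q s) (deriv q s)) =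
          fun s => (1 - u s)⁻¹ * deriv q s 1 := by
        funext s
        rw [momentum_eq, hα]
        rfl
      rw [hp]
      refine ((((hud s).const_sub 1).inv (hu1' s)).mul (hv1d s)).congr_deriv ?_
      have h1 : -((b - a) / 2 * sin (x s) * (L / (4 * M ^ 2) * u s ^ 2 * √(gap a b (x s)))) =
          u s ^ 2 / (2 * M) * deriv q s 1 := by
        rw [hv1]; field_simp; ring
      have h2 : -(u s ^ 2 / (2 * M) * deriv q s 1) / (1 - u s) ^ 2 * deriv q s 1 =
          -(u s ^ 2 / (2 * M)) / (1 - u s) ^ 2 * deriv q s 1 ^ 2 := by ring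
      rw [h1, h2, hv1sq, Pi.inv_apply]
      have h3 := hu1' s
      have h4 := (hu0 s).ne'
      generalize u s = y at *
      field_simp
      ring
    · have hp : (fun s => momentum M 2 (q s) (deriv q s)) = fun _ => 0 := by
        funext s
        rw [momentum_eq, hv2, mul_zero]
      change HasDerivAt (fun s => momentum M 2 (q s) (deriv q s))
        (force M 2 (q s) (deriv q s)) s
      rw [hp, force_colatitude M _ (hq2 s)]
      exact hasDerivAt_const s 0
    · change HasDerivAt (fun s => momentum M 3 (q s) (deriv q s))
        (force M 3 (q s) (deriv q s)) s
      rw [funext hangular, force_azimuth]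
      exact hasDerivAt_const s L
  · intro s
    have h1 := lagrangian_eq M (q s) (deriv q s)
    rw [hv1sq, hv0, hv2, hv3, hα, hq1, hq2, sin_pi_div_two, lagrangian] at h1
    have h3 := hu1' s
    have h4 := (hu0 s).ne'
    have h5 : -(1 - u s) * (-E / (1 - u s)) ^ 2 +
        (1 - u s)⁻¹ * (E ^ 2 - (1 - u s) * (1 + L ^ 2 / (4 * M ^ 2) * u s ^ 2)) +
        (2 * M / u s) ^ 2 * 0 ^ 2 +
        (2 * M / u s) ^ 2 * 1 ^ 2 * (L / (4 * M ^ 2) * u s ^ 2) ^ 2 = -1 := by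
      field_simp
      ring
    rw [h5] at h1
    linarith
  · rintro ⟨c, hc⟩
    obtain ⟨s₀, hs₀⟩ := hxs 0
    obtain ⟨s₁, hs₁⟩ := hxs π
    have h1 : u s₀ = a := by rw [← hus, hs₀, radial, cos_zero]; ring
    have h2 : u s₁ = b := by rw [← hus, hs₁, radial, cos_pi]; ring
    have h3 := (hc s₀).trans (hc s₁).symm
    rw [hq1, hq1, h1, h2] at h3
    have ha := h.pos
    have hb := h.pos.trans h.lt
    rw [div_eq_div_iff ha.ne' hb.ne'] at h3
    exact h.lt.ne' (mul_left_cancel₀ (by positivity) h3)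
  · refine ⟨d * P, by positivity, n, fun s => ⟨?_, ?_, ?_⟩⟩
    · rw [hq1, hq1, ← hus, ← hus, apply_add_nat_mul hxP, (radial_periodic a b).nat_mul d]
    · rw [hq2, hq2]
    · have hφx : ∀ s, φ (x (s + P)) = φ (x s) + apsidalIntegral a b := fun s => by
        rw [hxP, hφP]
      rw [hq3, hq3, apply_add_nat_mul (f := fun s => φ (x s)) hφx, hn]

/-! ### Density -/

/-- A function with nonvanishing derivative on an interval is nonconstant on every subinterval, so it
takes rational multiples of `c` there by the intermediate value theorem. -/
theorem Ioo_subset_closure_setOf_eq_mul_rat {f : ℝ → ℝ} {x y c : ℝ} (hc : 0 < c)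
    (hf : ∀ l ∈ Ioo x y, ∃ d, d ≠ 0 ∧ HasDerivAt f d l) :
    Ioo x y ⊆ closure {l ∈ Ioo x y | ∃ k : ℚ, f l = c * k} := by
  intro L hL
  rw [mem_closure_iff_nhds]
  intro t ht
  obtain ⟨ε, hε, hball⟩ := Metric.mem_nhds_iff.1 (Filter.inter_mem ht (Ioo_mem_nhds hL.1 hL.2))
  obtain ⟨d, hd, hder⟩ := hf L hL
  obtain ⟨L', hne, hL'⟩ := ((hder.eventually_ne hd (c := f L)).and
    (mem_nhdsWithin_of_mem_nhds (Metric.ball_mem_nhds L hε))).exists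
  have hsub : uIcc L L' ⊆ Metric.ball L ε :=
    ((convex_ball L ε).ordConnected).uIcc_subset (Metric.mem_ball_self hε) hL'
  have hcont : ContinuousOn f (uIcc L L') := fun l hl => by
    obtain ⟨_, _, h⟩ := hf l (hball (hsub hl)).2
    exact h.continuousAt.continuousWithinAt
  obtain ⟨k, hk1, hk2⟩ : ∃ k : ℚ, min (f L) (f L') / c < k ∧ k < max (f L) (f L') / c :=
    exists_rat_btwn (div_lt_div_of_pos_right (min_lt_max.2 (Ne.symm hne)) hc)
  rw [div_lt_iff₀' hc] at hk1
  rw [lt_div_iff₀' hc] at hk2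
  obtain ⟨l, hl, hlk⟩ := intermediate_value_uIcc hcont ⟨hk1.le, hk2.le⟩
  exact ⟨l, (hball (hsub hl)).1, (hball (hsub hl)).2, k, hlk⟩

end Schwarzschild

end

theorem mainTheorem5 (M E : ℝ) (hM : 0 < M) (hE : E ∈ Set.Ioo (√(25 / 27)) 1) :
    ∃ 𝓛 : Set ℝ,
      𝓛 ⊆ Set.Ioo (4 * M) (Schwarzschild.LE M E) ∧
      Set.Ioo (4 * M) (Schwarzschild.LE M E) ⊆ closure 𝓛 ∧
      ∀ L ∈ 𝓛,
        (∃ q : ℝ → Fin 4 → ℝ,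
          Schwarzschild.IsGeodesic M q ∧
          Schwarzschild.IsEquatorial q ∧
          Schwarzschild.IsTimelike M q ∧
          ¬ Schwarzschild.IsCircular q ∧
          Schwarzschild.IsSpatiallyClosed q ∧
          Schwarzschild.HasEnergy M E q ∧
          Schwarzschild.HasAngularMomentum M L q) ∧
        deriv (fun l => Schwarzschild.Theta M E (-1 / 2) l) L ≠ 0 := by
  refine ⟨{L ∈ Set.Ioo (4 * M) (Schwarzschild.LE M E) |
    ∃ k : ℚ, Schwarzschild.Theta M E (-1 / 2) L = 2 * π * k}, fun L hL => hL.1,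
    Schwarzschild.Ioo_subset_closure_setOf_eq_mul_rat two_pi_pos fun l hl => ?_, ?_⟩
  · obtain ⟨a, b, h⟩ := Schwarzschild.exists_isTurningPair hM hE hl
    exact Schwarzschild.exists_hasDerivAt_Theta hM (by linarith [hl.1]) h
  · rintro L ⟨hL, k, hk⟩
    have hL0 : 0 < L := by linarith [hL.1]
    obtain ⟨a, b, h⟩ := Schwarzschild.exists_isTurningPair hM hE hL
    refine ⟨Schwarzschild.exists_closed_geodesic hM hL0 h k.den_pos (n := k.num) ?_, ?_⟩
    · rw [← h.Theta_eq hM hL0, hk]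
      have : (k : ℝ) * k.den = k.num := by exact_mod_cast Rat.mul_den_eq_num k
      linear_combination 2 * π * this
    · obtain ⟨d, hd, hder⟩ := Schwarzschild.exists_hasDerivAt_Theta hM hL0 h
      rw [hder.deriv]
      exact hd
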